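/- Card guessing game. A deck consists of $n\ge 1$ distinct cards. A static Dealer fixes an ordering $d_1,\dots,d_n$ of the cards in advance and draws the cards in this order. In turn $i$ the Guesser guesses a card $g_i$, and then $d_i$ is revealed to her; the guess is correct if $g_i=d_i$. A Guesser with $m$ bits of memory and $r$ (long-lasting) random bits is given by a uniformly random string $\omega\in\{0,1\}^r$, fixed before the game, hidden from the Dealer and readable at any time; an initial memory state in $\{0,1\}^m$ determined by $\omega$; a state transition function, which assigns a new memory state in $\{0,1\}^m$ to $\omega$, the current memory state and the card drawn; and a guessing function, which assigns a card to $\omega$ and the current memory state. In addition the guessing function may use fresh random bits in every turn; these are not counted in $r$ and are not kept in memory. Theorem. There is a universal constant $C>0$ such that for every $n\ge 1$ and every $0<\delta\le 1$ there is a Guesser with at most $C\log_2(1/\delta)\log_2^2 n$ bits of memory and at most $C\log_2(1/\delta)\log_2^2 n$ random bits which, against every static Dealer (that is, for every ordering of the deck), makes at least $(1-\delta)\ln n$ correct guesses in expectation. -/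

import Mathlib

open scoped ENNReal

/-- A string of `k` bits. -/
abbrev Bits (k : ℕ) : Type := Fin k → Bool

/-- A Guesser for the card guessing game with the cards `Fin n`, with `m` bits of memory and `r`
long-lasting random bits.  The first argument `Bits r` of each component is the string of
long-lasting random bits, which can be read at any time and never changes.  The state transition
function and the guessing function are probabilistic: besides the long-lasting bits they may use
fresh ("on the fly") randomness, independently at every call. -/
structure Guesser (n m r : ℕ) where
  /-- The initial memory state. -/
  init : Bits r → Bits m
  /-- State transition function: memory state, card drawn ↦ (random) new memory state. -/
  step : Bits r → Bits m → Fin n → PMF (Bits m)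
  /-- Guessing function: memory state ↦ (random) card guessed. -/
  guess : Bits r → Bits m → PMF (Fin n)

namespace Guesser

variable {n m r : ℕ}

/-- The random bits used on the fly never enter the memory: the memory state is at all times
determined by the long-lasting random bits and by the cards drawn.  Thus every random bit that
influences more than a single guess is one of the `r` long-lasting random bits. -/
def NoFreshBitsInMemory (G : Guesser n m r) : Prop :=
  ∀ (ω : Bits r) (s : Bits m) (d : Fin n), ∃ s' : Bits m, G.step ω s d = PMF.pure s'

/-- The random transcript, the list of the pairs (card guessed, card drawn), when the long-lasting
random bits are `ω`, the current memory state is `s`, and the cards still to be drawn are, in this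
order, those of the given list.  In every turn the Guesser guesses from her memory state before the
drawn card is revealed to her. -/
noncomputable def playFrom (G : Guesser n m r) (ω : Bits r) :
    List (Fin n) → Bits m → PMF (List (Fin n × Fin n))
  | [], _ => PMF.pure []
  | d :: ds, s =>
      (G.guess ω s).bind fun g =>
        (G.step ω s d).bind fun s' =>
          (G.playFrom ω ds s').map fun T => (g, d) :: T

/-- The random transcript of the game against the static Dealer whose prearranged deck is `deck`
(`deck i` is the card drawn in turn `i`); the long-lasting random bits are uniformly random. -/
noncomputable def transcript (G : Guesser n m r) (deck : Equiv.Perm (Fin n)) :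
    PMF (List (Fin n × Fin n)) :=
  (PMF.uniformOfFintype (Bits r)).bind fun ω => G.playFrom ω (List.ofFn deck) (G.init ω)

/-- The number of correct guesses in a transcript. -/
def score (T : List (Fin n × Fin n)) : ℕ := T.countP fun p => p.1 = p.2

/-- The expected number of correct guesses against the static Dealer with the given deck. -/
noncomputable def expectedScore (G : Guesser n m r) (deck : Equiv.Perm (Fin n)) : ℝ≥0∞ :=
  ∑' T : List (Fin n × Fin n), G.transcript deck T * (score T : ℝ≥0∞)

end Guesser

/-!
When `t` cards remain, the next card is guessed correctly with probability `1 / t` by a uniformly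
random guess among the remaining cards, and the sum of these probabilities is the harmonic number
`H_n ≥ log (n + 1)`.  It therefore suffices to produce an almost uniform remaining card from a small
linear sketch of the set of the remaining cards.

For a random set `A` of cards, let the memory hold the number and the sum of the remaining cards in
`A`, modulo a power of two above `n`.  Both are updated when a card is drawn, and if exactly one
card of `A` remains, they reveal it.  If `A` has density `p` with `1 / 4 ≤ t * p ≤ 1 / 2`, this
happens with probability at least `1 / 8`, so that one of `O(log (1 / δ))` independent copies of `A`
succeeds with probability close to one.  One such family is kept for each of the `O(log n)` densities
`2 ^ -(i + 2)`.

Every remaining card must be revealed with almost the same probability, and fully independent sets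
`A` cost too many random bits.  It is enough that `A` is `k`-wise independent with
`k = O(log (1 / δ))`: the event that a given card is the only one of `A` that remains lies between
consecutive Bonferroni sums, which do not depend on the card and differ by an exponentially small
fraction (`KWiseIndep.expect_singleton_le_mul`).  The first successful copy then shows each card with
probability at least `(1 - O(2 ^ -k)) / t` (`KWiseIndep.le_expect_findSome`).  Random polynomials
with `k` coefficients over the field with `2 ^ w` elements provide such sets for all densities at
once (`exists_kWiseIndep`), where `w = O(log n)`.

The seeds take `O(log (1 / δ) ^ 2 * log n)` bits.  A loss below `1 / (n + 1) ^ 2` is never needed, as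
`log (n + 1)` exceeds `log n` by at least `1 / (n + 1)`; hence one factor `log (1 / δ)` may be
replaced by `O(log n)`.  If `δ > 1 / 2`, a constant loss is affordable in the last
`n ^ (2 * (1 - δ))` turns, and only the densities for these turns are kept, so that the memory is
proportional to `1 - δ`.  If the required score is at most one, no memory is needed at all: always
guessing the same card is correct once.
-/

open Finset BigOperators

/-! ### Guessers whose memory is a sum over the remaining cards -/

namespace Guesser

/-- The transcript of a deterministic Guesser whose memory is the sum of `v d` over the cards `d`
that are still in the deck and whose guess is `g` of the memory. -/
def detTranscript {n : ℕ} {M : Type*} [AddCommGroup M] (v : Fin n → M) (g : M → Fin n) :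
    List (Fin n) → List (Fin n × Fin n)
  | [] => []
  | d :: ds => (g (((d :: ds).map v).sum), d) :: detTranscript v g ds

/-- The Guesser whose memory holds (an encoding of) the sum of `v ω d` over the cards `d` that are
still in the deck. -/
noncomputable def ofSum {n m r : ℕ} {M Ω : Type*} [AddCommGroup M] (e : Bits r ≃ Ω)
    (enc : M → Bits m) (dec : Bits m → M) (v : Ω → Fin n → M) (g : M → Fin n) : Guesser n m r where
  init ω := enc (∑ d, v (e ω) d)
  step ω s d := PMF.pure (enc (dec s - v (e ω) d))
  guess _ s := PMF.pure (g (dec s))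

section

variable {n m r : ℕ} {M Ω : Type*} [AddCommGroup M] (e : Bits r ≃ Ω)
    (enc : M → Bits m) (dec : Bits m → M) (v : Ω → Fin n → M) (g : M → Fin n)

theorem playFrom_ofSum (h : ∀ s, dec (enc s) = s) (ω : Bits r) (l : List (Fin n)) :
    (ofSum e enc dec v g).playFrom ω l (enc ((l.map (v (e ω))).sum)) =
      PMF.pure (detTranscript (v (e ω)) g l) := by
  induction l with
  | nil => rfl
  | cons d ds ih =>
    have hs : ((ofSum e enc dec v g).step ω (enc (((d :: ds).map (v (e ω))).sum)) d) =
        PMF.pure (enc ((ds.map (v (e ω))).sum)) := by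
      simp [ofSum, h]
    have hg : ((ofSum e enc dec v g).guess ω (enc (((d :: ds).map (v (e ω))).sum))) =
        PMF.pure (g (((d :: ds).map (v (e ω))).sum)) := by
      simp only [ofSum, h]
    rw [playFrom, hs, hg, PMF.pure_bind, PMF.pure_bind, ih, PMF.pure_map]
    rfl

theorem expectedScore_ofSum [Fintype Ω] (h : ∀ s, dec (enc s) = s) (deck : Equiv.Perm (Fin n)) :
    (ofSum e enc dec v g).expectedScore deck =
      ENNReal.ofReal (𝔼 ω, (score (detTranscript (v ω) g (List.ofFn deck)) : ℝ)) := by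
  have h0 (ω : Bits r) : (ofSum e enc dec v g).playFrom ω (List.ofFn deck)
      ((ofSum e enc dec v g).init ω) =
        PMF.pure (detTranscript (v (e ω)) g (List.ofFn deck)) := by
    rw [← playFrom_ofSum e enc dec v g h]
    congr 1
    simp only [ofSum, List.map_ofFn, List.sum_ofFn]
    congr 1
    exact (Equiv.sum_comp deck (v (e ω))).symm
  have hc : Fintype.card (Bits r) = Fintype.card Ω := Fintype.card_congr e
  have hpos : (0 : ℝ) < Fintype.card Ω := by
    rw [← hc]; exact_mod_cast Fintype.card_pos
  unfold expectedScore transcript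
  simp only [h0, PMF.bind_apply, PMF.uniformOfFintype_apply]
  simp_rw [← ENNReal.tsum_mul_right]
  rw [ENNReal.tsum_comm]
  have h1 (ω : Bits r) : ∑' T : List (Fin n × Fin n), (Fintype.card (Bits r) : ℝ≥0∞)⁻¹ *
      (PMF.pure (detTranscript (v (e ω)) g (List.ofFn deck)) : PMF _) T * (score T : ℝ≥0∞) =
      ENNReal.ofReal ((Fintype.card Ω : ℝ)⁻¹ *
        score (detTranscript (v (e ω)) g (List.ofFn deck))) := by
    rw [tsum_eq_single (detTranscript (v (e ω)) g (List.ofFn deck))]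
    · rw [ENNReal.ofReal_mul (by positivity), ENNReal.ofReal_inv_of_pos hpos, hc]
      simp
    · intro T hT
      simp [PMF.pure_apply, hT]
  simp_rw [h1]
  rw [tsum_fintype, ← ENNReal.ofReal_sum_of_nonneg (fun _ _ => by positivity), ← Finset.mul_sum,
    Finset.expect_eq_sum_div_card, Finset.card_univ, div_eq_inv_mul,
    ← Equiv.sum_comp e (fun ω => (score (detTranscript (v ω) g (List.ofFn deck)) : ℝ))]

/-- A lower bound `c / t` for the probability of a correct guess when `t ≤ T` cards remain sums up
to a harmonic number. -/
theorem mul_harmonic_le_expect_score [Fintype Ω] {T : ℕ} {c : ℝ}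
    (hc : ∀ (d : Fin n) (ds : List (Fin n)), (d :: ds).Nodup → ds.length + 1 ≤ T →
      c / (ds.length + 1 : ℕ) ≤ 𝔼 ω, if g (((d :: ds).map (v ω)).sum) = d then (1 : ℝ) else 0)
    (l : List (Fin n)) (hl : l.Nodup) :
    c * (harmonic (min T l.length) : ℝ) ≤ 𝔼 ω, (score (detTranscript (v ω) g l) : ℝ) := by
  induction l with
  | nil => simp [detTranscript, score]
  | cons d ds ih =>
    have ih := ih hl.of_cons
    have hsc (ω : Ω) : (score (detTranscript (v ω) g (d :: ds)) : ℝ) =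
        score (detTranscript (v ω) g ds) +
          if g (((d :: ds).map (v ω)).sum) = d then (1 : ℝ) else 0 := by
      simp only [score, detTranscript, List.countP_cons]
      push_cast
      congr 1
      simp
    simp_rw [hsc, Finset.expect_add_distrib]
    by_cases hT : ds.length + 1 ≤ T
    · have := hc d ds hl hT
      rw [min_eq_right (by omega)] at ih
      rw [List.length_cons, min_eq_right hT, harmonic_succ]
      push_cast at this ⊢
      rw [mul_add, ← div_eq_mul_inv]
      linarith
    · have h0 : 0 ≤ 𝔼 ω, if g (((d :: ds).map (v ω)).sum) = d then (1 : ℝ) else 0 :=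
        Finset.expect_nonneg fun _ _ => by split_ifs <;> norm_num
      rw [min_eq_left (by omega)] at ih
      rw [List.length_cons, min_eq_left (by omega)]
      linarith

end

/-- The Guesser without memory and random bits who always guesses the same card is correct exactly
once. -/
theorem exists_memoryless (n : ℕ) (hn : 1 ≤ n) : ∃ G : Guesser n 0 0, G.NoFreshBitsInMemory ∧
    ∀ deck, G.expectedScore deck = 1 := by
  refine ⟨ofSum (M := Unit) (Equiv.refl _) (fun _ => 0) (fun _ => 0) (fun _ _ => 0)
    (fun _ => ⟨0, hn⟩), fun _ _ _ => ⟨_, rfl⟩, fun deck => ?_⟩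
  rw [expectedScore_ofSum _ _ _ _ _ (fun _ => rfl)]
  have key (l : List (Fin n)) : score (detTranscript (M := Unit) (fun _ => 0)
      (fun _ => ⟨0, hn⟩) l) = l.count ⟨0, hn⟩ := by
    induction l with
    | nil => rfl
    | cons d ds ih =>
      simp only [score, detTranscript, List.countP_cons, List.count_cons] at ih ⊢
      rw [ih]
      by_cases h : d = ⟨0, hn⟩
      · simp [h]
      · simp [h, Ne.symm h]
  change ENNReal.ofReal (𝔼 _ : Bits 0, (score (detTranscript (M := Unit) (fun _ => 0)
    (fun _ => ⟨0, hn⟩) (List.ofFn deck)) : ℝ)) = 1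
  rw [key, List.count_eq_one_of_mem (List.nodup_ofFn.mpr deck.injective)
    (by rw [List.mem_ofFn]; exact deck.surjective _)]
  simp

end Guesser

/-! ### Random polynomials -/

/-- The average of a function over a finite group can be pulled back along a surjective
homomorphism. -/
theorem expect_comp_of_surjective {G H : Type*} [AddCommGroup G] [AddCommGroup H] [Fintype G]
    [Fintype H] (φ : G →+ H) (hφ : Function.Surjective φ) (f : H → ℝ) :
    𝔼 x, f (φ x) = 𝔼 y, f y := by
  classical
  have hfib (y : H) : #{x | φ x = y} = #{x | φ x = 0} :=
    AddMonoidHom.card_fiber_eq_of_mem_range φ (hφ y) (hφ 0)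
  have hcard : Fintype.card G = Fintype.card H * #{x | φ x = 0} := by
    rw [← Finset.card_univ, Finset.card_eq_sum_card_fiberwise (f := φ) (t := univ)
      (fun _ _ => by simp), Finset.sum_congr rfl fun y _ => hfib y]
    simp
  have hpos : (0 : ℝ) < Fintype.card G := by exact_mod_cast Fintype.card_pos
  rw [hcard] at hpos
  push_cast at hpos
  rw [Finset.expect_eq_sum_div_card, Finset.expect_eq_sum_div_card, Finset.card_univ,
    Finset.card_univ, hcard, ← Finset.sum_fiberwise (s := univ) (g := φ)]
  have (y : H) : ∑ x with φ x = y, f (φ x) = (#{x | φ x = 0} : ℝ) * f y := by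
    rw [Finset.sum_congr rfl (g := fun _ => f y) fun x hx => by rw [(Finset.mem_filter.mp hx).2],
      Finset.sum_const, hfib, nsmul_eq_mul]
  simp_rw [this]
  rw [← Finset.mul_sum]
  push_cast
  have h1 : (#{x | φ x = 0} : ℝ) ≠ 0 := fun h => by simp [h] at hpos
  rw [mul_comm (Fintype.card H : ℝ), mul_div_mul_left _ _ h1]

/-- A random polynomial with `k` coefficients is `k`-wise independent: its values at `s` points,
`s ≤ k`, all lie in `B` with probability `(|B| / |F|) ^ s`. -/
theorem expect_forall_eval_mem {F : Type*} [Field F] [Fintype F] [DecidableEq F] {k : ℕ}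
    (B S : Finset F) (hS : #S ≤ k) :
    (𝔼 c : Fin k → F, if ∀ x ∈ S, ∑ i, c i * x ^ (i : ℕ) ∈ B then (1 : ℝ) else 0) =
      ((#B : ℝ) / Fintype.card F) ^ #S := by
  classical
  let φ : (Fin k → F) →+ (S → F) :=
    { toFun := fun c x => ∑ i, c i * (x : F) ^ (i : ℕ)
      map_zero' := by ext; simp
      map_add' := fun c d => by ext; simp [add_mul, Finset.sum_add_distrib] }
  have hφ : Function.Surjective φ := by
    intro y
    -- the coefficients of the Lagrange interpolation polynomial
    let y' : F → F := fun x => if h : x ∈ S then y ⟨x, h⟩ else 0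
    let P := Lagrange.interpolate S id y'
    have hinj : Set.InjOn (id : F → F) S := Function.injective_id.injOn
    refine ⟨fun i => P.coeff i, ?_⟩
    ext x
    have hdeg : P.degree < k :=
      (Lagrange.degree_interpolate_lt y' hinj).trans_le (by exact_mod_cast hS)
    have h1 : P.eval (x : F) = y x := by
      have := Lagrange.eval_interpolate_at_node y' hinj x.2
      simpa [P, y'] using this
    have h2 : P.eval (x : F) = ∑ i : Fin k, P.coeff i * (x : F) ^ (i : ℕ) := by
      rcases eq_or_ne P 0 with h0 | h0
      · simp [h0]
      · rw [Polynomial.eval_eq_sum_range' ((Polynomial.natDegree_lt_iff_degree_lt h0).mpr hdeg),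
          Finset.sum_range]
    exact h2.symm.trans h1
  have h3 := expect_comp_of_surjective φ hφ (fun y => if ∀ x, y x ∈ B then (1 : ℝ) else 0)
  have h4 : ∀ c : Fin k → F, (∀ x ∈ S, ∑ i, c i * x ^ (i : ℕ) ∈ B) ↔ ∀ x : S, φ c x ∈ B :=
    fun c => by simp [φ]
  simp_rw [h4]
  rw [h3, Finset.expect_eq_sum_div_card, Finset.card_univ, Finset.sum_boole]
  have h5 : (univ.filter fun y : S → F => ∀ x, y x ∈ B) = Fintype.piFinset fun _ => B := by
    ext; simp
  rw [h5, Fintype.card_piFinset]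
  simp [div_pow]

/-! ### Isolation of an element by a random set -/

theorem alternating_sum_choose_succ (N J : ℕ) :
    ∑ j ∈ range (J + 1), (-1 : ℝ) ^ j * ((N + 1).choose j) = (-1) ^ J * (N.choose J) := by
  induction J with
  | zero => simp
  | succ J ih =>
    rw [Finset.sum_range_succ, ih, Nat.choose_succ_succ]
    push_cast
    ring

/-- Bonferroni's inequality, truncated after an odd index. -/
theorem alternating_sum_choose_le (N b : ℕ) :
    ∑ j ∈ range (2 * b + 2), (-1 : ℝ) ^ j * (N.choose j) ≤ if N = 0 then 1 else 0 := by
  rcases N with _ | N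
  · rw [Finset.sum_eq_single 0]
    · simp
    · intro j _ hj
      simp [Nat.choose_eq_zero_of_lt (Nat.pos_of_ne_zero hj)]
    · simp
  · rw [alternating_sum_choose_succ]
    simp [pow_add, pow_mul]

/-- Bonferroni's inequality, truncated after an even index. -/
theorem le_alternating_sum_choose (N b : ℕ) :
    (if N = 0 then 1 else 0) ≤ ∑ j ∈ range (2 * b + 1), (-1 : ℝ) ^ j * (N.choose j) := by
  rcases N with _ | N
  · rw [Finset.sum_eq_single 0]
    · simp
    · intro j _ hj
      simp [Nat.choose_eq_zero_of_lt (Nat.pos_of_ne_zero hj)]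
    · simp
  · rw [alternating_sum_choose_succ]
    simp [pow_mul]

theorem filter_eq_singleton_iff {α : Type*} [DecidableEq α] {P : α → Prop} [DecidablePred P]
    {R : Finset α} {x : α} (hx : x ∈ R) :
    R.filter P = {x} ↔ P x ∧ #((R.erase x).filter P) = 0 := by
  rw [Finset.card_eq_zero, Finset.filter_eq_empty_iff]
  constructor
  · intro h
    have hx' : x ∈ R.filter P := by rw [h]; simp
    refine ⟨(Finset.mem_filter.mp hx').2, fun y hy hAy => ?_⟩
    have : y ∈ R.filter P := Finset.mem_filter.mpr ⟨Finset.mem_of_mem_erase hy, hAy⟩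
    rw [h, Finset.mem_singleton] at this
    exact Finset.ne_of_mem_erase hy this
  · rintro ⟨h1, h2⟩
    ext y
    simp only [Finset.mem_filter, Finset.mem_singleton]
    constructor
    · rintro ⟨hy, hAy⟩
      by_contra hne
      exact h2 (Finset.mem_erase.mpr ⟨hne, hy⟩) hAy
    · rintro rfl
      exact ⟨hx, h1⟩

section

variable {α Ω : Type*} [DecidableEq α] [Fintype Ω]

/-- The random set `A` (`A c x` says that `x` belongs to the set with the seed `c`) is `k`-wise
independent with density `p`: any `s ≤ k` given elements belong to it with probability `p ^ s`, for
a uniformly random seed. -/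
def KWiseIndep (k : ℕ) (p : ℝ) (A : Ω → α → Prop) [∀ c x, Decidable (A c x)] : Prop :=
  ∀ S : Finset α, #S ≤ k → (𝔼 c, if ∀ x ∈ S, A c x then (1 : ℝ) else 0) = p ^ #S

variable {k : ℕ} {p : ℝ} {A : Ω → α → Prop} [∀ c x, Decidable (A c x)]

/-- The moment of order `j` of the number of further elements of `A` in `R`. -/
theorem KWiseIndep.expect_choose (hA : KWiseIndep k p A) {R : Finset α} {x : α} (hx : x ∈ R)
    {j : ℕ} (hj : j + 1 ≤ k) :
    (𝔼 c, if A c x then ((#((R.erase x).filter (A c))).choose j : ℝ) else 0) =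
      (#R - 1).choose j * p ^ (j + 1) := by
  have h1 (c : Ω) : (if A c x then ((#((R.erase x).filter (A c))).choose j : ℝ) else 0) =
      ∑ S ∈ (R.erase x).powersetCard j, if ∀ y ∈ insert x S, A c y then (1 : ℝ) else 0 := by
    rw [← Finset.card_powersetCard]
    split_ifs with h
    · rw [Finset.sum_boole]
      congr 2
      ext S
      simp only [Finset.mem_powersetCard, Finset.mem_filter, Finset.subset_iff]
      constructor
      · rintro ⟨h2, h3⟩
        refine ⟨⟨fun y hy => (h2 hy).1, h3⟩, fun y hy => ?_⟩
        rcases Finset.mem_insert.mp hy with rfl | hy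
        · exact h
        · exact (h2 hy).2
      · rintro ⟨⟨h2, h3⟩, h4⟩
        exact ⟨fun y hy => ⟨h2 hy, h4 y (Finset.mem_insert_of_mem hy)⟩, h3⟩
    · symm
      refine Finset.sum_eq_zero fun S _ => if_neg fun h' => h (h' x (Finset.mem_insert_self _ _))
  simp_rw [h1]
  rw [Finset.expect_sum_comm]
  have h2 : ∀ S ∈ (R.erase x).powersetCard j,
      (𝔼 c, if ∀ y ∈ insert x S, A c y then (1 : ℝ) else 0) = p ^ (j + 1) := by
    intro S hS
    obtain ⟨hS, hc⟩ := Finset.mem_powersetCard.mp hS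
    have hc' : #(insert x S) = j + 1 := by
      rw [Finset.card_insert_of_notMem fun h => Finset.notMem_erase x R (hS h), hc]
    rw [hA _ (by omega), hc']
  rw [Finset.sum_congr rfl h2, Finset.sum_const, Finset.card_powersetCard,
    Finset.card_erase_of_mem hx, nsmul_eq_mul]

theorem KWiseIndep.expect_alternating (hA : KWiseIndep k p A) {R : Finset α} {x : α} (hx : x ∈ R)
    {J : ℕ} (hJ : J ≤ k) :
    (𝔼 c, if A c x then ∑ j ∈ range J, (-1 : ℝ) ^ j * (#((R.erase x).filter (A c))).choose j
      else 0) = ∑ j ∈ range J, (-1 : ℝ) ^ j * ((#R - 1).choose j * p ^ (j + 1)) := by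
  have h1 (c : Ω) : (if A c x then ∑ j ∈ range J, (-1 : ℝ) ^ j *
      (#((R.erase x).filter (A c))).choose j else 0) = ∑ j ∈ range J, (-1 : ℝ) ^ j *
        (if A c x then ((#((R.erase x).filter (A c))).choose j : ℝ) else 0) := by
    split_ifs <;> simp
  simp_rw [h1]
  rw [Finset.expect_sum_comm]
  refine Finset.sum_congr rfl fun j hj => ?_
  rw [← Finset.mul_expect, hA.expect_choose hx (by have := Finset.mem_range.mp hj; omega)]

theorem KWiseIndep.le_expect_singleton (hA : KWiseIndep k p A) {R : Finset α} {x : α} (hx : x ∈ R)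
    {b : ℕ} (hb : 2 * b + 2 ≤ k) :
    ∑ j ∈ range (2 * b + 2), (-1 : ℝ) ^ j * ((#R - 1).choose j * p ^ (j + 1)) ≤
      𝔼 c, if R.filter (A c) = {x} then (1 : ℝ) else 0 := by
  rw [← hA.expect_alternating hx hb]
  refine Finset.expect_le_expect fun c _ => ?_
  have := alternating_sum_choose_le #((R.erase x).filter (A c)) b
  simp only [filter_eq_singleton_iff hx]
  by_cases h : A c x
  · simpa only [h, true_and, if_true] using this
  · simp [h]

theorem KWiseIndep.expect_singleton_le (hA : KWiseIndep k p A) {R : Finset α} {x : α} (hx : x ∈ R)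
    {b : ℕ} (hb : 2 * b + 1 ≤ k) :
    (𝔼 c, if R.filter (A c) = {x} then (1 : ℝ) else 0) ≤
      ∑ j ∈ range (2 * b + 1), (-1 : ℝ) ^ j * ((#R - 1).choose j * p ^ (j + 1)) := by
  rw [← hA.expect_alternating hx hb]
  refine Finset.expect_le_expect fun c _ => ?_
  have := le_alternating_sum_choose #((R.erase x).filter (A c)) b
  simp only [filter_eq_singleton_iff hx]
  by_cases h : A c x
  · simpa only [h, true_and, if_true] using this
  · simp [h]

/-- Isolating `x` has probability at least half of that of sampling it. -/
theorem KWiseIndep.half_le_expect_singleton (hA : KWiseIndep k p A) (hk : 2 ≤ k) (hp : 0 ≤ p)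
    {R : Finset α} (hR : #R * p ≤ 1 / 2) {x : α} (hx : x ∈ R) :
    p / 2 ≤ 𝔼 c, if R.filter (A c) = {x} then (1 : ℝ) else 0 := by
  refine le_trans ?_ (hA.le_expect_singleton hx (b := 0) (by omega))
  have h1 : ((#R - 1 : ℕ) : ℝ) ≤ #R := by exact_mod_cast Nat.sub_le _ _
  have h2 : ((#R - 1 : ℕ) : ℝ) * p ≤ 1 / 2 := (mul_le_mul_of_nonneg_right h1 hp).trans hR
  have h3 := mul_le_mul_of_nonneg_right h2 hp
  simp only [Finset.sum_range_succ, Finset.sum_range_zero, mul_zero, zero_add]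
  norm_num
  nlinarith

/-- All elements of `R` are isolated with nearly the same probability: consecutive Bonferroni sums
are close to each other and do not depend on the element. -/
theorem KWiseIndep.expect_singleton_le_mul (hA : KWiseIndep k p A) {b : ℕ} (hk : 2 * b + 3 ≤ k)
    (hp : 0 ≤ p) {R : Finset α} (hR : #R * p ≤ 1 / 2) {x y : α} (hx : x ∈ R) (hy : y ∈ R) :
    (𝔼 c, if R.filter (A c) = {y} then (1 : ℝ) else 0) ≤
      (1 + (1 / 2) ^ (2 * b + 1)) * 𝔼 c, if R.filter (A c) = {x} then (1 : ℝ) else 0 := by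
  have h1 := hA.expect_singleton_le hy (b := b + 1) (by omega)
  have h2 := hA.le_expect_singleton hx (b := b) (by omega)
  have h3 := hA.half_le_expect_singleton (by omega) hp hR hx
  have h4 : ((#R - 1).choose (2 * b + 2) : ℝ) * p ^ (2 * b + 2) ≤ (1 / 2) ^ (2 * b + 2) := by
    have h5 : ((#R - 1).choose (2 * b + 2) : ℝ) ≤ (#R : ℝ) ^ (2 * b + 2) := by
      exact_mod_cast (Nat.choose_le_pow _ _).trans (Nat.pow_le_pow_left (Nat.sub_le _ _) _)
    calc _ ≤ (#R : ℝ) ^ (2 * b + 2) * p ^ (2 * b + 2) := by gcongr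
      _ = (#R * p) ^ (2 * b + 2) := by rw [mul_pow]
      _ ≤ _ := by gcongr
  rw [show 2 * (b + 1) + 1 = (2 * b + 2) + 1 by ring, Finset.sum_range_succ] at h1
  have h6 : (-1 : ℝ) ^ (2 * b + 2) = 1 := by rw [show 2 * b + 2 = 2 * (b + 1) by ring, pow_mul]; simp
  rw [h6, one_mul, pow_succ p (2 * b + 2), ← mul_assoc] at h1
  have h7 := mul_le_mul_of_nonneg_right h4 hp
  have h8 : (1 / 2 : ℝ) ^ (2 * b + 2) * p = (1 / 2) ^ (2 * b + 1) * (p / 2) := by ring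
  have h9 : (1 / 2 : ℝ) ^ (2 * b + 1) * (p / 2) ≤ (1 / 2) ^ (2 * b + 1) *
      𝔼 c, if R.filter (A c) = {x} then (1 : ℝ) else 0 := by gcongr
  linarith

end

/-! ### The first success of independent trials -/

section

variable {α Ω : Type*} [DecidableEq α] [Fintype Ω]

theorem expect_fin_succ {L : ℕ} (f : (Fin (L + 1) → Ω) → ℝ) :
    𝔼 ω, f ω = 𝔼 a, 𝔼 ω, f (Fin.cons a ω) := by
  simp only [Finset.expect_eq_sum_div_card, Finset.card_univ, ← Finset.sum_div, div_div]
  rw [← Equiv.sum_comp (Fin.consEquiv fun _ => Ω) f, Fintype.sum_prod_type]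
  simp [pow_succ, Fin.consEquiv]

/-- Among `L` independent trials, the first that does not fail has outcome `x` with the probability
of the outcome `x` of one trial times a geometric sum that does not depend on `x`. -/
theorem expect_findSome [Nonempty Ω] (D : Ω → Option α) (x : α) (L : ℕ) :
    (𝔼 ω : Fin L → Ω, if (List.ofFn fun j => D (ω j)).findSome? id = some x then (1 : ℝ) else 0) =
      (𝔼 c, if D c = some x then (1 : ℝ) else 0) *
        ∑ j ∈ range L, (𝔼 c, if D c = none then (1 : ℝ) else 0) ^ j := by
  induction L with
  | zero => simp
  | succ L ih =>
    rw [expect_fin_succ]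
    have h (a : Ω) : (𝔼 ω : Fin L → Ω, if (List.ofFn fun j : Fin (L + 1) =>
        D ((Fin.cons a ω : Fin (L + 1) → Ω) j)).findSome? id = some x then (1 : ℝ) else 0) =
        (if D a = some x then (1 : ℝ) else 0) + (if D a = none then (1 : ℝ) else 0) *
          𝔼 ω : Fin L → Ω, if (List.ofFn fun j => D (ω j)).findSome? id = some x
            then (1 : ℝ) else 0 := by
      rcases hD : D a with _ | y
      · simp [List.ofFn_succ, hD]
      · simp [List.ofFn_succ, hD]
    simp_rw [h]
    rw [Finset.expect_add_distrib, ← Finset.expect_mul, ih, Finset.sum_range_succ', pow_zero]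
    simp_rw [pow_succ]
    rw [← Finset.sum_mul]
    ring

end

section

variable {α Ω : Type*} [DecidableEq α] [Fintype Ω] {k : ℕ} {p : ℝ} {A : Ω → α → Prop}
  [∀ c x, Decidable (A c x)]

/-- `L` independent copies of the random set `A` are tried, and the first that isolates an element
of `R` is used.  Each given element of `R` results with nearly the probability `1 / |R|`. -/
theorem KWiseIndep.le_expect_findSome [Nonempty Ω] (hA : KWiseIndep k p A) {b L : ℕ}
    (hk : 2 * b + 3 ≤ k) (hL : 6 * (2 * b + 1) ≤ L) (hp : 0 ≤ p) {R : Finset α}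
    (hR : 1 / 4 ≤ #R * p) (hR' : #R * p ≤ 1 / 2) (D : Ω → Option α)
    (hD : ∀ c y, D c = some y ↔ R.filter (A c) = {y}) {x : α} (hx : x ∈ R) :
    (1 - (1 / 4) ^ b) / #R ≤
      𝔼 ω : Fin L → Ω, if (List.ofFn fun j => D (ω j)).findSome? id = some x
        then (1 : ℝ) else 0 := by
  rw [expect_findSome]
  simp_rw [hD]
  set qx := 𝔼 c, if R.filter (A c) = {x} then (1 : ℝ) else 0
  set z := 𝔼 c, if D c = none then (1 : ℝ) else 0
  set η : ℝ := (1 / 2) ^ (2 * b + 1) with hη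
  have hη0 : 0 ≤ η := by positivity
  have hηb : (1 / 4 : ℝ) ^ b = 2 * η := by
    rw [hη, pow_succ, pow_mul]; norm_num; ring
  have hpos : (0 : ℝ) < #R := by exact_mod_cast Finset.card_pos.mpr ⟨x, hx⟩
  have hz0 : 0 ≤ z := Finset.expect_nonneg fun _ _ => by split_ifs <;> norm_num
  have hsum : (∑ y ∈ R, 𝔼 c, if R.filter (A c) = {y} then (1 : ℝ) else 0) + z = 1 := by
    rw [← Finset.expect_sum_comm, ← Finset.expect_add_distrib]
    rw [← Fintype.expect_one (ι := Ω) (M := ℝ)]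
    refine Finset.expect_congr rfl fun c _ => ?_
    simp_rw [← hD]
    rcases hDc : D c with _ | y
    · simp
    · have hy : y ∈ R := by
        have : y ∈ R.filter (A c) := by rw [(hD c y).mp hDc]; simp
        exact (Finset.mem_filter.mp this).1
      simp [hy]
  have hup : 1 - z ≤ #R * ((1 + η) * qx) := by
    rw [sub_eq_of_eq_add hsum.symm, ← nsmul_eq_mul]
    exact Finset.sum_le_card_nsmul _ _ _ fun y hy => hA.expect_singleton_le_mul hk hp hR' hx hy
  have hlo : 1 / 8 ≤ 1 - z := by
    have h1 : #R * (p / 2) ≤ 1 - z := by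
      rw [sub_eq_of_eq_add hsum.symm, ← nsmul_eq_mul]
      exact Finset.card_nsmul_le_sum _ _ _ fun y hy =>
        hA.half_le_expect_singleton (by omega) hp hR' hy
    linarith
  have hzL : z ^ L ≤ η := by
    calc z ^ L ≤ (7 / 8) ^ L := pow_le_pow_left₀ hz0 (by linarith) _
      _ ≤ (7 / 8) ^ (6 * (2 * b + 1)) := pow_le_pow_of_le_one (by norm_num) (by norm_num) hL
      _ = ((7 / 8) ^ 6) ^ (2 * b + 1) := by rw [pow_mul]
      _ ≤ η := pow_le_pow_left₀ (by norm_num) (by norm_num) _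
  set s := ∑ j ∈ range L, z ^ j
  have hs0 : 0 ≤ s := Finset.sum_nonneg fun _ _ => pow_nonneg hz0 _
  have hgeom : (1 - z) * s = 1 - z ^ L := by rw [mul_comm]; exact geom_sum_mul_neg z L
  have h2 : 1 - η ≤ #R * ((1 + η) * qx) * s := by
    calc 1 - η ≤ (1 - z) * s := by rw [hgeom]; linarith
      _ ≤ _ := mul_le_mul_of_nonneg_right hup hs0
  rw [hηb, div_le_iff₀ hpos]
  have h3 : (1 - 2 * η) * (1 + η) ≤ (qx * s * #R) * (1 + η) := by nlinarith
  exact le_of_mul_le_mul_right h3 (by linarith)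

end

/-! ### The sketch of the remaining cards -/

/-- The card stored in a memory cell, if the first component of the cell says that a single card
is left.  The test `s.2.val < n` only serves to define the function on sums of other cells. -/
def decodeCell {n N : ℕ} (s : ZMod N × ZMod N) : Option (Fin n) :=
  if s.1 = 1 then (if h : s.2.val < n then some ⟨s.2.val, h⟩ else none) else none

theorem sum_cell {n N : ℕ} (P : Fin n → Prop) [DecidablePred P] {l : List (Fin n)}
    (hl : l.Nodup) :
    (l.map fun d => if P d then ((1 : ZMod N), ((d : ℕ) : ZMod N)) else 0).sum =
      (((#(l.toFinset.filter P) : ℕ) : ZMod N), ∑ d ∈ l.toFinset.filter P, ((d : ℕ) : ZMod N)) := by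
  rw [← List.sum_toFinset _ hl, ← Finset.sum_filter]
  ext <;> simp [Prod.fst_sum, Prod.snd_sum]

theorem decodeCell_eq_some_iff {n N : ℕ} (hN : n < N) (P : Fin n → Prop) [DecidablePred P]
    {l : List (Fin n)} (hl : l.Nodup) (x : Fin n) :
    decodeCell (l.map fun d => if P d then ((1 : ZMod N), ((d : ℕ) : ZMod N)) else 0).sum =
      some x ↔ l.toFinset.filter P = {x} := by
  rw [sum_cell P hl]
  set R := l.toFinset.filter P
  have hR : #R < N := by
    have := Finset.card_le_univ R
    rw [Fintype.card_fin] at this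
    omega
  have hval (y : Fin n) : ((y : ℕ) : ZMod N).val = y := ZMod.val_natCast_of_lt (y.2.trans hN)
  have hone : ((#R : ℕ) : ZMod N) = 1 ↔ #R = 1 := by
    constructor
    · intro h
      rcases Nat.lt_or_ge 1 N with h1 | h1
      · have := congrArg ZMod.val h
        rw [ZMod.val_natCast_of_lt hR] at this
        rw [this, ← Nat.cast_one, ZMod.val_natCast_of_lt h1]
      · have := x.2
        omega
    · intro h
      simp [h]
  constructor
  · intro h
    have h1 : #R = 1 := by
      by_contra h1
      rw [decodeCell, if_neg (mt hone.mp h1)] at h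
      exact absurd h (by simp)
    obtain ⟨y, hy⟩ := Finset.card_eq_one.mp h1
    rw [hy] at h ⊢
    simpa [decodeCell, hval] using h
  · intro h
    simp [decodeCell, h, hval]

theorem exists_field (w : ℕ) (hw : w ≠ 0) :
    ∃ (F : Type) (_ : Field F) (_ : Fintype F), Fintype.card F = 2 ^ w := by
  have : Fact (Nat.Prime 2) := ⟨Nat.prime_two⟩
  have := Fintype.ofFinite (GaloisField 2 w)
  exact ⟨GaloisField 2 w, inferInstance, inferInstance, by
    rw [← Nat.card_eq_fintype_card, GaloisField.card 2 w hw]⟩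

/-- With `k * w` random bits there are `k`-wise independent random subsets of `Fin n` of all the
densities `2 ^ -(i + 2)`, `i + 2 ≤ w`.  The same bits serve all densities: nothing is claimed about
subsets of different densities jointly. -/
theorem exists_kWiseIndep {n w k : ℕ} (hw : w ≠ 0) (hn : n ≤ 2 ^ w) :
    ∃ (Ω : Type) (_ : Fintype Ω) (A : ℕ → Ω → Fin n → Prop)
      (_ : ∀ i c x, Decidable (A i c x)), Fintype.card Ω = 2 ^ (k * w) ∧
      ∀ i, i + 2 ≤ w → KWiseIndep k ((1 / 2) ^ (i + 2)) (A i) := by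
  classical
  obtain ⟨F, _, _, hF⟩ := exists_field w hw
  have e : F ≃ Fin (2 ^ w) := Fintype.equivOfCardEq (by simp [hF])
  obtain ⟨φ⟩ : Nonempty (Fin n ↪ F) :=
    Function.Embedding.nonempty_of_card_le (by simpa [hF] using hn)
  let B (i : ℕ) : Finset F := univ.filter fun y => (e y : ℕ) < 2 ^ (w - (i + 2))
  have hB (i : ℕ) (hi : i + 2 ≤ w) : (#(B i) : ℝ) / Fintype.card F = (1 / 2) ^ (i + 2) := by
    have h1 : #(B i) = 2 ^ (w - (i + 2)) := by
      have h2 : (B i).map e.toEmbedding = univ.filter fun y : Fin (2 ^ w) =>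
          (y : ℕ) < 2 ^ (w - (i + 2)) := by
        ext y
        simp only [B, Finset.mem_map_equiv, Finset.mem_filter, Finset.mem_univ, true_and,
          Equiv.apply_symm_apply]
      rw [← Finset.card_map e.toEmbedding, h2, Fin.card_filter_val_lt]
      exact min_eq_right (Nat.pow_le_pow_right (by norm_num) (Nat.sub_le _ _))
    rw [h1, hF]
    push_cast
    rw [div_eq_iff (by positivity), one_div, inv_pow, eq_inv_mul_iff_mul_eq₀ (by positivity),
      ← pow_add, Nat.add_sub_cancel' hi]
  refine ⟨Fin k → F, inferInstance, fun i c x => ∑ j, c j * φ x ^ (j : ℕ) ∈ B i, inferInstance,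
    ?_, fun i hi S hS => ?_⟩
  · simp [hF, ← pow_mul, mul_comm]
  · rw [← hB i hi, ← Finset.card_map φ,
      ← expect_forall_eval_mem (k := k) (B i) (S.map φ) (by simpa using hS)]
    simp only [Finset.forall_mem_map]
    congr!

/-- The Guesser keeps, for every scale `i ≤ log₂ T` and every copy, the number and the sum of the
remaining cards of a random set, and also the number of all remaining cards.  When `t` cards remain,
she uses the sets of density `2 ^ -(log₂ t + 2)`, and guesses the card that the first successful
copy reveals. -/
theorem exists_guesser {n T : ℕ} (b : ℕ) (hn : 1 ≤ n) (hTn : T ≤ n) :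
    ∃ G : Guesser n (2 * (Nat.log 2 n + 3) * ((Nat.log 2 T + 1) * (6 * (2 * b + 1)) + 1))
        (6 * (2 * b + 1) * ((2 * b + 3) * (Nat.log 2 n + 3))),
      G.NoFreshBitsInMemory ∧ ∀ deck : Equiv.Perm (Fin n),
        ENNReal.ofReal ((1 - (1 / 4) ^ b) * (harmonic T : ℝ)) ≤ G.expectedScore deck := by
  set w := Nat.log 2 n + 3 with hw
  set S := Nat.log 2 T + 1 with hS
  set L := 6 * (2 * b + 1) with hL
  set k := 2 * b + 3 with hk
  have hnw : n < 2 ^ w := (Nat.lt_pow_succ_log_self (by norm_num) n).trans_le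
    (Nat.pow_le_pow_right (by norm_num) (by omega))
  obtain ⟨Ω, _, A, _, hΩ, hA⟩ := exists_kWiseIndep (k := k) (by omega : w ≠ 0) hnw.le
  have : Nonempty Ω := Fintype.card_pos_iff.mp (by rw [hΩ]; positivity)
  have : NeZero (2 ^ w) := ⟨by positivity⟩
  let C := ZMod (2 ^ w) × ZMod (2 ^ w)
  let M := Option (Fin S × Fin L) → C
  have e : Bits (L * (k * w)) ≃ (Fin L → Ω) :=
    Fintype.equivOfCardEq (by simp [hΩ, ← pow_mul, mul_comm])
  have enc : M ≃ Bits (2 * w * (S * L + 1)) := by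
    refine Fintype.equivOfCardEq ?_
    simp only [M, C, Fintype.card_prod, ZMod.card, Fintype.card_option,
      Fintype.card_fin, Fintype.card_bool, Fintype.card_pi, Finset.prod_const, Finset.card_univ]
    rw [← pow_add, ← pow_mul, two_mul]
  -- the cards of the set `P` count, the others do not
  let cell (P : Fin n → Prop) [DecidablePred P] (d : Fin n) : C := if P d then (1, (d : ℕ)) else 0
  let v (ω : Fin L → Ω) (d : Fin n) : M
    | none => cell (fun _ => True) d
    | some (i, j) => cell (A i (ω j)) d
  let g (s : M) : Fin n :=
    ((List.ofFn fun j : Fin L =>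
      decodeCell (s (some (Fin.ofNat S (Nat.log 2 (s none).1.val), j)))).findSome? id).getD ⟨0, hn⟩
  refine ⟨Guesser.ofSum e enc enc.symm v g, fun _ _ _ => ⟨_, rfl⟩, fun deck => ?_⟩
  rw [Guesser.expectedScore_ofSum _ _ _ _ _ enc.symm_apply_apply]
  refine ENNReal.ofReal_le_ofReal ?_
  have key := Guesser.mul_harmonic_le_expect_score v g (T := T) (c := 1 - (1 / 4) ^ b) ?_
    (List.ofFn deck) (List.nodup_ofFn.mpr deck.injective)
  · rwa [List.length_ofFn, min_eq_left hTn] at key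
  intro d ds hnd hlen
  set l := d :: ds with hl
  have hcard : #l.toFinset = ds.length + 1 := by rw [List.toFinset_card_of_nodup hnd]; rfl
  set t := ds.length + 1 with ht
  have hlog : Nat.log 2 t ≤ Nat.log 2 T := Nat.log_mono_right hlen
  have hlogn : Nat.log 2 T ≤ Nat.log 2 n := Nat.log_mono_right hTn
  have happ (ω : Fin L → Ω) (i) : (l.map (v ω)).sum i = (l.map fun d => v ω d i).sum := by
    have := map_list_sum (Pi.evalAddMonoidHom (fun _ : Option (Fin S × Fin L) => C) i)
      (l.map (v ω))
    rw [List.map_map] at this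
    exact this
  have hclock (ω : Fin L → Ω) : ((l.map (v ω)).sum none).1.val = t := by
    rw [happ]
    have := sum_cell (N := 2 ^ w) (fun _ => True) hnd
    change ((l.map fun d : Fin n => if True then ((1 : ZMod (2 ^ w)), ((d : ℕ) : ZMod (2 ^ w)))
      else 0).sum).1.val = t
    rw [this]
    simp only [Finset.filter_true, hcard]
    exact ZMod.val_natCast_of_lt (by omega)
  -- `2 ^ i ≤ t < 2 ^ (i + 1)`, so that the expected size of the sample is between 1/4 and 1/2
  set i := Nat.log 2 t with hi
  have hiS : ((Fin.ofNat S i : Fin S) : ℕ) = i := Nat.mod_eq_of_lt (by omega)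
  have h1 : (2 : ℝ) ^ i ≤ t := by exact_mod_cast Nat.pow_log_le_self 2 (by omega)
  have h2 : (t : ℝ) ≤ 2 ^ (i + 1) := by
    exact_mod_cast (Nat.lt_pow_succ_log_self (by norm_num) t).le
  have h3 : (0 : ℝ) ≤ (1 / 2) ^ (i + 2) := by positivity
  have h4 : (2 : ℝ) ^ i * (1 / 2) ^ (i + 2) = 1 / 4 := by
    rw [pow_add, ← mul_assoc, ← mul_pow]; norm_num
  let D (c : Ω) : Option (Fin n) := decodeCell (l.map (cell (A i c))).sum
  have hfin := (hA i (by omega)).le_expect_findSome (b := b) (L := L) le_rfl le_rfl h3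
    (R := l.toFinset) (by rw [hcard, ← h4]; gcongr)
    (by rw [hcard]
        calc (t : ℝ) * (1 / 2) ^ (i + 2) ≤ 2 ^ (i + 1) * (1 / 2) ^ (i + 2) := by gcongr
          _ = 2 * (2 ^ i * (1 / 2) ^ (i + 2)) := by ring
          _ = 1 / 2 := by rw [h4]; norm_num)
    D (fun c y => decodeCell_eq_some_iff hnw (A i c) hnd y) (x := d) (by simp [hl])
  rw [hcard] at hfin
  refine hfin.trans (Finset.expect_le_expect fun ω _ => ?_)
  have hcells (j : Fin L) :
      decodeCell ((l.map (v ω)).sum (some (Fin.ofNat S i, j))) = D (ω j) := by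
    rw [happ]
    change decodeCell (l.map (cell (A (Fin.ofNat S i : Fin S) (ω j)))).sum = D (ω j)
    rw [hiS]
  have hg : g (l.map (v ω)).sum =
      ((List.ofFn fun j => D (ω j)).findSome? id).getD ⟨0, hn⟩ := by
    simp only [g, hclock]
    simp_rw [← hi, hcells]
  rw [hg]
  split_ifs with h5 h6 h6
  · exact le_rfl
  · exact absurd (by rw [h5]; rfl) h6
  · norm_num
  · exact le_rfl

/-! ### Choice of the parameters -/

/-- If `4 ^ b` is at least `(n + 1) ^ 2`, the loss `(1 / 4) ^ b` is paid for by the difference of `log (n + 1)` and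
`log n`. -/
theorem log_le_mul_log_add_one {n b : ℕ} (hn : 1 ≤ n) (hb : n + 1 ≤ 2 ^ b) :
    Real.log n ≤ (1 - (1 / 4) ^ b) * Real.log (n + 1 : ℕ) := by
  have hn0 : (0 : ℝ) < n := by exact_mod_cast hn
  have h1 : 1 / ((n : ℝ) + 1) ≤ Real.log (n + 1 : ℕ) - Real.log n := by
    rw [← Real.log_div (by positivity) (by positivity)]
    have := Real.one_sub_inv_le_log_of_pos (x := ((n + 1 : ℕ) : ℝ) / n) (by positivity)
    refine le_trans (le_of_eq ?_) this
    push_cast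
    field_simp
    ring
  have h2 : ((n : ℝ) + 1) ≤ 2 ^ b := by exact_mod_cast hb
  have h3 : (1 / 4 : ℝ) ^ b ≤ 1 / ((n : ℝ) + 1) ^ 2 := by
    rw [one_div_pow]
    have : (4 : ℝ) ^ b = (2 ^ b) ^ 2 := by rw [← pow_mul, mul_comm, pow_mul]; norm_num
    rw [this]
    gcongr
  have h4 : Real.log (n + 1 : ℕ) ≤ (n : ℝ) + 1 := by
    push_cast
    exact Real.log_le_self (by positivity)
  have h5 : (1 / 4 : ℝ) ^ b * Real.log (n + 1 : ℕ) ≤ 1 / ((n : ℝ) + 1) := by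
    calc _ ≤ 1 / ((n : ℝ) + 1) ^ 2 * ((n : ℝ) + 1) := by
          refine mul_le_mul h3 h4 (Real.log_natCast_nonneg _) (by positivity)
      _ = _ := by field_simp
  linarith

theorem natLog_two_le_logb (n : ℕ) : (Nat.log 2 n : ℝ) ≤ Real.logb 2 n := by
  exact_mod_cast Real.natLog_le_logb n 2

theorem mainTheorem3 :
    ∃ C : ℝ, 0 < C ∧
      ∀ (n : ℕ), 1 ≤ n → ∀ (δ : ℝ), 0 < δ → δ ≤ 1 →
        ∃ m r : ℕ,
          (m : ℝ) ≤ C * (Real.logb 2 (1 / δ) * Real.logb 2 (n : ℝ) ^ 2) ∧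
          (r : ℝ) ≤ C * (Real.logb 2 (1 / δ) * Real.logb 2 (n : ℝ) ^ 2) ∧
          ∃ G : Guesser n m r, G.NoFreshBitsInMemory ∧
            ∀ deck : Equiv.Perm (Fin n),
              ENNReal.ofReal ((1 - δ) * Real.log (n : ℝ)) ≤ G.expectedScore deck := by
  refine ⟨1320, by norm_num, fun n hn δ hδ hδ1 => ?_⟩
  have hn1 : (1 : ℝ) ≤ n := by exact_mod_cast hn
  set x := Real.logb 2 (n : ℝ) with hx
  set D := Real.logb 2 (1 / δ) with hD
  have hx0 : 0 ≤ x := Real.logb_nonneg (by norm_num) hn1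
  have hD0 : 0 ≤ D := Real.logb_nonneg (by norm_num) ((one_le_div hδ).mpr hδ1)
  rcases le_or_gt ((1 - δ) * Real.log n) 1 with hsmall | hlarge
  · obtain ⟨G, hG, hs⟩ := Guesser.exists_memoryless n hn
    refine ⟨0, 0, by simpa using by positivity, by simpa using by positivity, G, hG, fun deck => ?_⟩
    rw [hs]
    exact ENNReal.ofReal_le_one.mpr hsmall
  have hlog2 : Real.log 2 ≤ 1 := (Real.log_le_sub_one_of_pos (by norm_num)).trans (by norm_num)
  have hlog2' : 0 < Real.log 2 := Real.log_pos (by norm_num)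
  have hlogn : 0 ≤ Real.log n := Real.log_natCast_nonneg n
  have hlogx : Real.log n ≤ x := le_div_self hlogn hlog2' hlog2
  have hδD : 1 - δ ≤ D := by
    have h1 := Real.one_sub_inv_le_log_of_pos (x := 1 / δ) (by positivity)
    rw [one_div, inv_inv, ← one_div] at h1
    exact h1.trans (le_div_self ((sub_nonneg.mpr hδ1).trans h1) hlog2' hlog2)
  have hx1 : 1 ≤ x := by nlinarith
  have hDx : 1 ≤ D * x := hlarge.le.trans (mul_le_mul hδD hlogx hlogn hD0)
  have hw : (Nat.log 2 n : ℝ) + 3 ≤ 4 * x := by linarith [natLog_two_le_logb n]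
  rcases le_or_gt δ (1 / 2) with hδ2 | hδ2
  · have hD1 : 1 ≤ D := by
      rw [hD, Real.le_logb_iff_rpow_le (by norm_num) (by positivity), Real.rpow_one,
        le_div_iff₀ hδ]
      linarith
    -- there is no need for a loss below `1 / (n + 1) ^ 2`
    set b := min ⌈D⌉₊ (Nat.log 2 n + 3) with hb
    obtain ⟨G, hG, hs⟩ := exists_guesser (n := n) (T := n) b hn le_rfl
    have hbD : (b : ℝ) ≤ 2 * D := by
      have h1 : (b : ℝ) ≤ ⌈D⌉₊ := by exact_mod_cast min_le_left _ _
      linarith [Nat.ceil_lt_add_one hD0]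
    have hbx : (b : ℝ) ≤ 4 * x := by
      refine le_trans ?_ hw
      exact_mod_cast min_le_right _ _
    have hL : 6 * (2 * (b : ℝ) + 1) ≤ 30 * D := by linarith
    refine ⟨_, _, ?_, ?_, G, hG, fun deck => le_trans (ENNReal.ofReal_le_ofReal ?_) (hs deck)⟩
    · push_cast
      have hS : (Nat.log 2 n : ℝ) + 1 ≤ 2 * x := by linarith [natLog_two_le_logb n]
      calc _ ≤ 2 * (4 * x) * ((2 * x) * (30 * D) + D * x) := by gcongr
        _ = 488 * (D * x ^ 2) := by ring
        _ ≤ _ := by gcongr; norm_num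
    · push_cast
      calc _ ≤ 30 * D * ((11 * x) * (4 * x)) := by gcongr; linarith
        _ = 1320 * (D * x ^ 2) := by ring
    · have hH : Real.log (n + 1 : ℕ) ≤ harmonic n := log_add_one_le_harmonic n
      have h1 : (0 : ℝ) ≤ 1 - (1 / 4) ^ b :=
        sub_nonneg.mpr (pow_le_one₀ (by norm_num) (by norm_num))
      refine le_trans ?_ (mul_le_mul_of_nonneg_left hH h1)
      rcases min_choice ⌈D⌉₊ (Nat.log 2 n + 3) with h2 | h2
      · have h3 : (1 / 4 : ℝ) ^ b ≤ δ := by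
          calc (1 / 4 : ℝ) ^ b ≤ (1 / 2) ^ b := by gcongr; norm_num
            _ = (2 ^ (b : ℝ))⁻¹ := by rw [Real.rpow_natCast, one_div, inv_pow]
            _ ≤ (2 ^ D)⁻¹ := by
              gcongr
              · norm_num
              · rw [hb, h2]; exact Nat.le_ceil D
            _ = δ := by
              rw [hD, Real.rpow_logb (by norm_num) (by norm_num) (by positivity), one_div, inv_inv]
        refine mul_le_mul (by linarith) ?_ hlogn h1
        exact Real.log_le_log (by linarith) (by push_cast; linarith)
      · refine le_trans (by nlinarith) (log_le_mul_log_add_one hn (b := b) ?_)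
        rw [hb, h2]
        exact (Nat.lt_pow_succ_log_self (by norm_num) n).trans_le
          (Nat.pow_le_pow_right (by norm_num) (by omega))
  · -- the last `T` turns suffice, and a Guesser who loses a constant factor there
    set y : ℝ := (n : ℝ) ^ (2 * (1 - δ)) with hy
    set T := ⌊y⌋₊ with hT
    have hy0 : 0 < y := by positivity
    have hyn : y ≤ n := by
      calc y ≤ (n : ℝ) ^ (1 : ℝ) := Real.rpow_le_rpow_of_exponent_le hn1 (by linarith)
        _ = n := Real.rpow_one _
    have hTy : (T : ℝ) ≤ y := Nat.floor_le hy0.le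
    have hy1 : 1 ≤ y := Real.one_le_rpow hn1 (by linarith)
    have hT1 : 1 ≤ T := Nat.le_floor (by simpa using hy1)
    have hTn : T ≤ n := by exact_mod_cast hTy.trans hyn
    obtain ⟨G, hG, hs⟩ := exists_guesser 1 hn hTn
    have hlogT : (Nat.log 2 T : ℝ) ≤ 2 * (D * x) := by
      calc (Nat.log 2 T : ℝ) ≤ Real.logb 2 T := natLog_two_le_logb T
        _ ≤ Real.logb 2 y :=
          Real.logb_le_logb_of_le (by norm_num) (by exact_mod_cast hT1) hTy
        _ = 2 * (1 - δ) * x := Real.logb_rpow_eq_mul_logb_of_pos (by linarith)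
        _ ≤ 2 * D * x := by gcongr
        _ = _ := by ring
    refine ⟨_, _, ?_, ?_, G, hG, fun deck => le_trans (ENNReal.ofReal_le_ofReal ?_) (hs deck)⟩
    · push_cast
      calc _ ≤ 2 * (4 * x) * ((3 * (D * x)) * (6 * (2 * 1 + 1)) + D * x) := by
            gcongr
            · linarith
            · norm_num
        _ = 440 * (D * x ^ 2) := by ring
        _ ≤ _ := by gcongr; norm_num
    · push_cast
      calc _ ≤ 6 * (2 * 1 + 1) * ((2 * 1 + 3) * (4 * x)) := by
            gcongr <;> norm_num
        _ = 360 * x * 1 := by ring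
        _ ≤ 360 * x * (D * x) := by gcongr
        _ = 360 * (D * x ^ 2) := by ring
        _ ≤ _ := by gcongr; norm_num
    · have hH : Real.log (T + 1 : ℕ) ≤ harmonic T := log_add_one_le_harmonic T
      have h1 : 2 * (1 - δ) * Real.log n ≤ Real.log (T + 1 : ℕ) := by
        rw [← Real.log_rpow (by linarith)]
        refine Real.log_le_log hy0 ?_
        push_cast
        exact (Nat.lt_floor_add_one y).le
      norm_num
      nlinarith
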